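/- Let $R$ be a commutative ring and $S\subseteq R$ a multiplicative subset (containing $1$; zero divisors, even $0$, are allowed), and write $R_S$ for the localization. A short exact sequence $\eta$ of $R$-modules is \emph{$S$-pure exact} if it is pure exact, $\eta\otimes_R R_S$ is split exact over $R_S$, and $\eta\otimes_R R/sR$ is split exact over $R/sR$ for every $s\in S$. A module is \emph{$S$-pure injective} if it is injective with respect to all $S$-pure exact sequences; an \emph{$S$-pure injective preenvelope} of $K$ is a morphism $e:K\to E$ with $E$ $S$-pure injective through which every morphism from $K$ to an $S$-pure injective module factors. A morphism $f:G\to Z$ is \emph{$S$-phantom} if the pullback along $f$ of every short exact sequence $0\to X\to Y\to Z\to 0$ is $S$-pure exact; let $S\text{-}\mathrm{Ph}$ be the class of these morphisms. For classes $\mathcal I,\mathcal J$ of morphisms put $\mathcal I^\perp=\{j:\mathrm{Ext}^1_R(i,j)=0\ \forall i\in\mathcal I\}$ and ${}^\perp\mathcal J=\{i:\mathrm{Ext}^1_R(i,j)=0\ \forall j\in\mathcal J\}$. An $\mathcal I$-precover of $M$ is a morphism $i:X\to M$ in $\mathcal I$ through which every morphism $X'\to M$ in $\mathcal I$ factors;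 it is \emph{special} if it is the epimorphism in a short exact sequence $0\to N\to X\xrightarrow{i} M\to 0$ that is the pushout of a short exact sequence $0\to Z\to Y\to M\to 0$ along some $j:Z\to N$ in $\mathcal I^\perp$. Dually, a $\mathcal J$-preenvelope of $M$ is a morphism $j:M\to X$ in $\mathcal J$ through which every morphism $M\to X'$ in $\mathcal J$ factors; it is special if it is the monomorphism in a short exact sequence $0\to M\xrightarrow{j} X\to Q\to 0$ that is the pullback of a short exact sequence $0\to M\to Y\to Z\to 0$ along some $i:Q\to Z$ in ${}^\perp\mathcal J$. A pair of ideals $(\mathcal I,\mathcal J)$ is an ideal cotorsion pair if $\mathcal J=\mathcal I^\perp$ and $\mathcal I={}^\perp\mathcal J$; it is complete if moreover every module has a special $\mathcal I$-precover and a special $\mathcal J$-preenvelope. \textbf{Theorem.} (1) $S\text{-}\mathrm{Ph}$ is a two-sided ideal of the category of $R$-modules, and every $R$-module has a special $S\text{-}\mathrm{Ph}$-precover; that is, $S\text{-}\mathrm{Ph}$ is special precovering. (2) $(S\text{-}\mathrm{Ph},(S\text{-}\mathrm{Ph})^\perp)$ is a complete ideal cotorsion pair. (3) Every $R$-module has an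 $S$-pure injective preenvelope. If $0\to K\to P\to M\to 0$ is a short exact sequence of $R$-modules with $P$ projective and $e:K\to E$ is any $S$-pure injective preenvelope (for instance an $S$-pure injective envelope, if $K$ has one), then $e\in(S\text{-}\mathrm{Ph})^\perp$, and in the pushout sequence $0\to E\to F\xrightarrow{f} M\to 0$ along $e$, which is exact, the morphism $f$ is a special $S\text{-}\mathrm{Ph}$-precover of $M$. -/

import Mathlib

open CategoryTheory

universe u

noncomputable section

namespace SPhantom

/-! ### Purity and `S`-purity of short exact sequences -/

section Purity

variable {R : Type u} [CommRing R]

/-- The complex `A ⊗_R N ⟶ A ⊗_R M ⟶ A ⊗_R L` of `A`-modules obtained from the complex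
`N ⟶ M ⟶ L` of `R`-modules, for an `R`-algebra `A`. -/
def baseChangeComplex (A : Type u) [CommRing A] [Algebra R A]
    (η : ShortComplex (ModuleCat.{u} R)) : ShortComplex (ModuleCat.{u} A) :=
  ShortComplex.mk
    (ModuleCat.ofHom (η.f.hom.baseChange A)) (ModuleCat.ofHom (η.g.hom.baseChange A)) (by
      rw [← ModuleCat.ofHom_comp, ← LinearMap.baseChange_comp, ← ModuleCat.hom_comp, η.zero,
        ModuleCat.hom_zero, LinearMap.baseChange_zero, ModuleCat.ofHom_zero])

/-- A short exact sequence `0 → N → M → L → 0` of `R`-modules is pure exact if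
`T ⊗ N → T ⊗ M` is injective for every `R`-module `T` (equivalently, since tensor products are
right exact, if it remains short exact after tensoring with any `T`). -/
def IsPureExact (η : ShortComplex (ModuleCat.{u} R)) : Prop :=
  η.ShortExact ∧
    ∀ T : ModuleCat.{u} R, Function.Injective (LinearMap.lTensor T η.f.hom)

/-- A short exact sequence of `R`-modules is `S`-pure exact if it is pure exact, it splits over
the localization `R_S` after tensoring with `R_S`, and for every `s ∈ S` it splits over `R ⧸ sR`
after tensoring with `R ⧸ sR`. -/
def IsSPureExact (S : Submonoid R) (η : ShortComplex (ModuleCat.{u} R)) : Prop :=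
  IsPureExact η ∧
    Nonempty (baseChangeComplex (Localization S) η).Splitting ∧
    ∀ s ∈ S, Nonempty (baseChangeComplex (R ⧸ Ideal.span {s}) η).Splitting

/-- An `R`-module `Y` is `S`-pure injective if it is injective with respect to all `S`-pure exact
sequences. -/
def IsSPureInjective (S : Submonoid R) (Y : ModuleCat.{u} R) : Prop :=
  ∀ η : ShortComplex (ModuleCat.{u} R), IsSPureExact S η →
    ∀ h : η.X₁ ⟶ Y, ∃ g : η.X₂ ⟶ Y, η.f ≫ g = h

/-- `e : K ⟶ E` is an `S`-pure injective preenvelope of `K`: the module `E` is `S`-pure injective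
and every morphism from `K` to an `S`-pure injective module factors through `e`. -/
def IsSPureInjectivePreenvelope (S : Submonoid R) {K E : ModuleCat.{u} R} (e : K ⟶ E) : Prop :=
  IsSPureInjective S E ∧
    ∀ (Y : ModuleCat.{u} R), IsSPureInjective S Y → ∀ h : K ⟶ Y, ∃ g : E ⟶ Y, e ≫ g = h

/-- A morphism `f : G ⟶ Z` of `R`-modules is `S`-phantom if for every short exact sequence
`η : 0 → X → Y → Z → 0` the pullback `0 → X → U → G → 0` of `η` along `f` is `S`-pure exact. -/
def SPh (S : Submonoid R) : MorphismProperty (ModuleCat.{u} R) := fun G Z f =>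
  ∀ (X Y : ModuleCat.{u} R) (i : X ⟶ Y) (p : Y ⟶ Z) (w : i ≫ p = 0),
    (ShortComplex.mk i p w).ShortExact →
    ∀ (U : ModuleCat.{u} R) (i' : X ⟶ U) (p' : U ⟶ G) (g : U ⟶ Y) (w' : i' ≫ p' = 0),
      IsPullback g p' p f → i' ≫ g = i → IsSPureExact S (ShortComplex.mk i' p' w')

end Purity

/-! ### Ideal approximation theory in the category of `R`-modules

A class of morphisms is a `MorphismProperty`. -/

section Ideals

variable {R : Type u} [CommRing R]

/-- A class of morphisms is a (two-sided) ideal of the category of `R`-modules if it meets each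
group `Hom(A, B)` in a subgroup and is closed under composition with arbitrary morphisms on
both sides. -/
structure IsIdeal (I : MorphismProperty (ModuleCat.{u} R)) : Prop where
  zero (A B : ModuleCat.{u} R) : I (0 : A ⟶ B)
  add {A B : ModuleCat.{u} R} (f g : A ⟶ B) : I f → I g → I (f + g)
  neg {A B : ModuleCat.{u} R} (f : A ⟶ B) : I f → I (-f)
  comp {C A B D : ModuleCat.{u} R} (h : C ⟶ A) (f : A ⟶ B) (g : B ⟶ D) : I f → I (h ≫ f ≫ g)

/-- `Ext¹_R(f, g) = 0` for `f : A ⟶ B` and `g : C ⟶ D`: the induced map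
`Ext¹_R(B, C) → Ext¹_R(A, D)` is zero. -/
def ExtVanishes {A B C D : ModuleCat.{u} R} (f : A ⟶ B) (g : C ⟶ D) : Prop :=
  ∀ x : Abelian.Ext.{u} B C 1,
    ((Abelian.Ext.mk₀ f).comp x (zero_add 1)).comp (Abelian.Ext.mk₀ g) (add_zero 1) = 0

/-- `I^⊥`, the class of all `j` such that `Ext¹_R(i, j) = 0` for all `i ∈ I`. -/
def rightPerp (I : MorphismProperty (ModuleCat.{u} R)) : MorphismProperty (ModuleCat.{u} R) :=
  fun _ _ j => ∀ (A B : ModuleCat.{u} R) (i : A ⟶ B), I i → ExtVanishes i j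

/-- `^⊥J`, the class of all `i` such that `Ext¹_R(i, j) = 0` for all `j ∈ J`. -/
def leftPerp (J : MorphismProperty (ModuleCat.{u} R)) : MorphismProperty (ModuleCat.{u} R) :=
  fun _ _ i => ∀ (C D : ModuleCat.{u} R) (j : C ⟶ D), J j → ExtVanishes i j

/-- `i : X ⟶ M` is an `I`-precover of `M`. -/
def IsPrecover (I : MorphismProperty (ModuleCat.{u} R)) {X M : ModuleCat.{u} R}
    (i : X ⟶ M) : Prop :=
  I i ∧ ∀ (X' : ModuleCat.{u} R) (i' : X' ⟶ M), I i' → ∃ h : X' ⟶ X, h ≫ i = i'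

/-- `j : M ⟶ X` is a `J`-preenvelope of `M`. -/
def IsPreenvelope (J : MorphismProperty (ModuleCat.{u} R)) {M X : ModuleCat.{u} R}
    (j : M ⟶ X) : Prop :=
  J j ∧ ∀ (X' : ModuleCat.{u} R) (j' : M ⟶ X'), J j' → ∃ h : X ⟶ X', j ≫ h = j'

/-- An `I`-precover `i : X ⟶ M` is special if it occurs in a pushout diagram with exact rows
```
0 ⟶ Z ⟶ Y ⟶ M ⟶ 0
    |j   |    ‖
0 ⟶ N ⟶ X ⟶ M ⟶ 0
          i
```
with `j ∈ I^⊥`. -/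
def IsSpecialPrecover (I : MorphismProperty (ModuleCat.{u} R)) {X M : ModuleCat.{u} R}
    (i : X ⟶ M) : Prop :=
  IsPrecover I i ∧
    ∃ (Z Y N : ModuleCat.{u} R) (z : Z ⟶ Y) (y : Y ⟶ M) (w : z ≫ y = 0)
      (j : Z ⟶ N) (n : N ⟶ X) (h : Y ⟶ X) (w' : n ≫ i = 0),
      (ShortComplex.mk z y w).ShortExact ∧ (ShortComplex.mk n i w').ShortExact ∧
      rightPerp I j ∧ IsPushout z j h n ∧ h ≫ i = y

/-- A `J`-preenvelope `j : M ⟶ X` is special if it occurs in a pullback diagram with exact rows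
```
      j
0 ⟶ M ⟶ X ⟶ Q ⟶ 0
    ‖    |    |i
0 ⟶ M ⟶ Y ⟶ Z ⟶ 0
```
with `i ∈ ^⊥J`. -/
def IsSpecialPreenvelope (J : MorphismProperty (ModuleCat.{u} R)) {M X : ModuleCat.{u} R}
    (j : M ⟶ X) : Prop :=
  IsPreenvelope J j ∧
    ∃ (Y Z Q : ModuleCat.{u} R) (y : M ⟶ Y) (z : Y ⟶ Z) (w : y ≫ z = 0)
      (i : Q ⟶ Z) (q : X ⟶ Q) (h : X ⟶ Y) (w' : j ≫ q = 0),
      (ShortComplex.mk y z w).ShortExact ∧ (ShortComplex.mk j q w').ShortExact ∧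
      leftPerp J i ∧ IsPullback h q z i ∧ j ≫ h = y

/-- Every module has a special `I`-precover. -/
def IsSpecialPrecovering (I : MorphismProperty (ModuleCat.{u} R)) : Prop :=
  ∀ M : ModuleCat.{u} R, ∃ (X : ModuleCat.{u} R) (i : X ⟶ M), IsSpecialPrecover I i

/-- Every module has a special `J`-preenvelope. -/
def IsSpecialPreenveloping (J : MorphismProperty (ModuleCat.{u} R)) : Prop :=
  ∀ M : ModuleCat.{u} R, ∃ (X : ModuleCat.{u} R) (j : M ⟶ X), IsSpecialPreenvelope J j

/-- A pair `(I, J)` of ideals with `J = I^⊥` and `I = ^⊥J`. -/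
structure IsIdealCotorsionPair (I J : MorphismProperty (ModuleCat.{u} R)) : Prop where
  isIdeal_left : IsIdeal I
  isIdeal_right : IsIdeal J
  right_eq : J = rightPerp I
  left_eq : I = leftPerp J

/-- An ideal cotorsion pair `(I, J)` is complete if `I` is special precovering and `J` is special
preenveloping. -/
structure IsCompleteIdealCotorsionPair (I J : MorphismProperty (ModuleCat.{u} R)) : Prop where
  isIdealCotorsionPair : IsIdealCotorsionPair I J
  isSpecialPrecovering : IsSpecialPrecovering I
  isSpecialPreenveloping : IsSpecialPreenveloping J

end Ideals

end SPhantom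

end

open SPhantom

/-! Write `K⁺` for the character module. The map from `K` to the product of `K⁺⁺`, `R_S ⊗ K` and all
`R ⧸ sR ⊗ K` is an `S`-pure monomorphism into an `S`-pure injective module (`isSPure_toSPureHull`,
`isSPureInjective_sPureHull`), hence a preenvelope. A short exact sequence starting in `K` is
therefore `S`-pure once this single map extends over its middle term. In terms of `Ext¹`, `f` is
`S`-phantom exactly when `Ext¹(f, E) = 0` for all `S`-pure injective `E` (`sPh_iff`), which makes
`S-Ph` an ideal equal to its double perpendicular.

Pushing a projective presentation of `M` out along a preenvelope `K ⟶ E` gives an `S`-phantom `f : F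
⟶ M`; since `1_E` lies in `S-Ph^⊥`, it is a special precover. Special preenvelopes follow by the
ideal form of Salce's lemma. -/

namespace SPhantom

/-! ### `S`-pure monomorphisms and the `S`-pure injective hull construction. -/

section Purity

open TensorProduct

variable {R : Type u} [CommRing R]

/-- The base change of `f` along `R → A` admits an `A`-linear retraction. -/
def HasBaseChangeRetraction (A : Type u) [CommRing A] [Algebra R A] {X Y : ModuleCat.{u} R}
    (f : X ⟶ Y) : Prop :=
  ∃ r : A ⊗[R] Y →ₗ[A] A ⊗[R] X, r ∘ₗ f.hom.baseChange A = LinearMap.id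

/-- The conditions on the monomorphism of a short exact sequence that make the sequence `S`-pure
exact. -/
structure IsSPure (S : Submonoid R) {X Y : ModuleCat.{u} R} (f : X ⟶ Y) : Prop where
  lTensor_injective (T : ModuleCat.{u} R) : Function.Injective (LinearMap.lTensor T f.hom)
  localization : HasBaseChangeRetraction (Localization S) f
  quotient (s : R) (hs : s ∈ S) : HasBaseChangeRetraction (R ⧸ Ideal.span {s}) f

theorem baseChangeComplex_exact (A : Type u) [CommRing A] [Algebra R A]
    {η : ShortComplex (ModuleCat.{u} R)} (hη : η.ShortExact) :
    (baseChangeComplex A η).Exact := by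
  rw [ShortComplex.ShortExact.moduleCat_exact_iff_function_exact]
  exact lTensor_exact A ((ShortComplex.ShortExact.moduleCat_exact_iff_function_exact η).1 hη.exact)
    hη.moduleCat_surjective_g

theorem baseChangeComplex_epi (A : Type u) [CommRing A] [Algebra R A]
    {η : ShortComplex (ModuleCat.{u} R)} (hη : η.ShortExact) :
    Epi (baseChangeComplex A η).g := by
  rw [ModuleCat.epi_iff_surjective]
  exact LinearMap.lTensor_surjective A hη.moduleCat_surjective_g

/-- Right exactness of base change gives everything but a retraction, so `S`-purity becomes a
condition on the monomorphism alone. -/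
theorem nonempty_splitting_baseChangeComplex_iff (A : Type u) [CommRing A] [Algebra R A]
    {η : ShortComplex (ModuleCat.{u} R)} (hη : η.ShortExact) :
    Nonempty (baseChangeComplex A η).Splitting ↔ HasBaseChangeRetraction A η.f := by
  constructor
  · rintro ⟨σ⟩
    exact ⟨σ.r.hom, congrArg ModuleCat.Hom.hom σ.f_r⟩
  · rintro ⟨r, hr⟩
    exact ⟨ShortComplex.Splitting.ofExactOfRetraction _ (baseChangeComplex_exact A hη)
      (ModuleCat.ofHom r) (ModuleCat.hom_ext hr) (baseChangeComplex_epi A hη)⟩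

theorem isSPureExact_iff (S : Submonoid R) {η : ShortComplex (ModuleCat.{u} R)}
    (hη : η.ShortExact) : IsSPureExact S η ↔ IsSPure S η.f := by
  constructor
  · rintro ⟨⟨-, h₁⟩, h₂, h₃⟩
    exact ⟨h₁, (nonempty_splitting_baseChangeComplex_iff _ hη).1 h₂,
      fun s hs => (nonempty_splitting_baseChangeComplex_iff _ hη).1 (h₃ s hs)⟩
  · rintro ⟨h₁, h₂, h₃⟩
    exact ⟨⟨hη, h₁⟩, (nonempty_splitting_baseChangeComplex_iff _ hη).2 h₂,
      fun s hs => (nonempty_splitting_baseChangeComplex_iff _ hη).2 (h₃ s hs)⟩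

theorem HasBaseChangeRetraction.of_comp {A : Type u} [CommRing A] [Algebra R A]
    {X Y Z : ModuleCat.{u} R} {f : X ⟶ Y} {g : Y ⟶ Z} (h : HasBaseChangeRetraction A (f ≫ g)) :
    HasBaseChangeRetraction A f := by
  obtain ⟨r, hr⟩ := h
  refine ⟨r ∘ₗ g.hom.baseChange A, ?_⟩
  rw [← hr, ModuleCat.hom_comp, LinearMap.baseChange_comp, LinearMap.comp_assoc]

theorem IsSPure.of_comp {S : Submonoid R} {X Y Z : ModuleCat.{u} R} {f : X ⟶ Y} {g : Y ⟶ Z}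
    (h : IsSPure S (f ≫ g)) : IsSPure S f where
  lTensor_injective T := by
    have := h.lTensor_injective T
    rw [ModuleCat.hom_comp, LinearMap.lTensor_comp] at this
    exact Function.Injective.of_comp this
  localization := h.localization.of_comp
  quotient s hs := (h.quotient s hs).of_comp

theorem IsSPure.mono {S : Submonoid R} {X Y : ModuleCat.{u} R} {f : X ⟶ Y} (h : IsSPure S f) :
    Mono f := by
  rw [ModuleCat.mono_iff_injective]
  have h1 := h.lTensor_injective (ModuleCat.of R R)
  intro x y hxy
  have h2 : (1 : R) ⊗ₜ[R] x = 1 ⊗ₜ y := h1 (by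
    change (1 : R) ⊗ₜ[R] f.hom x = 1 ⊗ₜ f.hom y
    exact congrArg _ hxy)
  simpa using congrArg (TensorProduct.lid R X) h2

/-- Morphisms into (restrictions of scalars of) `A`-modules extend along `f` if the base change of
`f` to `A` has a retraction. -/
theorem HasBaseChangeRetraction.exists_extension {A : Type u} [CommRing A] [Algebra R A]
    {X Y : ModuleCat.{u} R} {f : X ⟶ Y} (h : HasBaseChangeRetraction A f)
    {N : Type u} [AddCommGroup N] [Module R N] [Module A N] [IsScalarTower R A N]
    (k : X →ₗ[R] N) : ∃ g : Y →ₗ[R] N, g ∘ₗ f.hom = k := by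
  obtain ⟨r, hr⟩ := h
  -- The extension is `y ↦ k̃ (r (1 ⊗ y))`, where `k̃ : A ⊗ X → N` is the `A`-linear map adjoint to
  -- `k`.
  refine ⟨((LinearMap.liftBaseChange A k ∘ₗ r).restrictScalars R) ∘ₗ TensorProduct.mk R A Y 1, ?_⟩
  ext x
  have := LinearMap.congr_fun hr (1 ⊗ₜ x)
  simp only [LinearMap.comp_apply, LinearMap.baseChange_tmul, LinearMap.id_apply] at this
  simp [this]

theorem hasBaseChangeRetraction_of_extension (A : Type u) [CommRing A] [Algebra R A]
    {X Y : ModuleCat.{u} R} (f : X ⟶ Y) (g : Y →ₗ[R] A ⊗[R] X)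
    (h : g ∘ₗ f.hom = TensorProduct.mk R A X 1) : HasBaseChangeRetraction A f := by
  refine ⟨LinearMap.liftBaseChange A g, ?_⟩
  ext x
  simpa using LinearMap.congr_fun h x

/-- Morphisms into a character module extend along pure monomorphisms. -/
theorem exists_extension_characterModule {X Y : ModuleCat.{u} R} {f : X ⟶ Y}
    {N : Type u} [AddCommGroup N] [Module R N]
    (hf : Function.Injective (LinearMap.lTensor N f.hom)) (k : X →ₗ[R] CharacterModule N) :
    ∃ g : Y →ₗ[R] CharacterModule N, g ∘ₗ f.hom = k := by
  have hf' : Function.Injective (LinearMap.rTensor N f.hom) := by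
    rwa [LinearMap.lTensor_inj_iff_rTensor_inj] at hf
  -- By tensor-hom adjunction, maps into `N⁺` are characters of the tensor product with `N`, and
  -- characters extend along injections.
  exact (rTensor_injective_iff_lcomp_surjective.1 hf') k

/-- The evaluation of a module in its double character module. -/
def evalCharacter (K : Type u) [AddCommGroup K] [Module R K] :
    K →ₗ[R] CharacterModule (CharacterModule K) where
  toFun x :=
    { toFun := fun c => c x
      map_zero' := rfl
      map_add' := fun _ _ => rfl }
  map_add' x y := by
    ext c
    exact map_add c x y
  map_smul' r x := by
    ext c
    rfl

/-- Characters separate points, and every character `c` of `T ⊗ K` extends to `T ⊗ K⁺⁺`: curry it to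
`T → K⁺` and follow with the evaluation `K⁺ → K⁺⁺⁺`. -/
theorem lTensor_evalCharacter_injective (K T : Type u) [AddCommGroup K] [Module R K]
    [AddCommGroup T] [Module R T] :
    Function.Injective (LinearMap.lTensor T (evalCharacter (R := R) K)) := by
  rw [injective_iff_map_eq_zero]
  intro y hy
  refine CharacterModule.eq_zero_of_character_apply fun c => ?_
  let φ : T →ₗ[R] CharacterModule K := CharacterModule.curry c
  let c' : CharacterModule (T ⊗[R] CharacterModule (CharacterModule K)) :=
    CharacterModule.uncurry (evalCharacter (R := R) (CharacterModule K) ∘ₗ φ)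
  have key : ∀ z, c' (LinearMap.lTensor T (evalCharacter (R := R) K) z) = c z := by
    intro z
    induction z with
    | zero => simp
    | add a b ha hb => rw [map_add, map_add, map_add, ha, hb]
    | tmul t x => rfl
  rw [← key, hy, map_zero]

/-- The product of the modules that detect `S`-purity: `K⁺⁺`, `R_S ⊗ K` and all
`R ⧸ sR ⊗ K`. -/
abbrev SPureHull (S : Submonoid R) (K : ModuleCat.{u} R) : ModuleCat.{u} R :=
  ModuleCat.of R (CharacterModule (CharacterModule K) × (Localization S ⊗[R] K) ×
    (∀ s : S, (R ⧸ Ideal.span {(s : R)}) ⊗[R] K))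

/-- The canonical morphism into `SPureHull S K`. -/
def toSPureHull (S : Submonoid R) (K : ModuleCat.{u} R) : K ⟶ SPureHull S K :=
  ModuleCat.ofHom ((evalCharacter K).prod ((TensorProduct.mk R _ K 1).prod
    (LinearMap.pi fun _ => TensorProduct.mk R _ K 1)))

/-- Each factor witnesses one condition: `K⁺⁺` gives purity, and projection onto `A ⊗ K` extends the
unit map `K → A ⊗ K`, which yields the retraction over `A`. -/
theorem isSPure_toSPureHull (S : Submonoid R) (K : ModuleCat.{u} R) :
    IsSPure S (toSPureHull S K) where
  lTensor_injective T := by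
    have h := lTensor_evalCharacter_injective (R := R) K T
    have h' : evalCharacter (R := R) K = LinearMap.fst R _ _ ∘ₗ (toSPureHull S K).hom := rfl
    rw [h', LinearMap.lTensor_comp] at h
    exact Function.Injective.of_comp h
  localization := hasBaseChangeRetraction_of_extension _ _
    (LinearMap.fst R _ _ ∘ₗ LinearMap.snd R _ _) rfl
  quotient s hs := hasBaseChangeRetraction_of_extension _ _
    (LinearMap.proj (⟨s, hs⟩ : S) ∘ₗ LinearMap.snd R _ _ ∘ₗ LinearMap.snd R _ _) rfl

theorem isSPureInjective_sPureHull (S : Submonoid R) (K : ModuleCat.{u} R) :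
    IsSPureInjective S (SPureHull S K) := by
  intro η hη k
  obtain ⟨h₁, h₂, h₃⟩ := (isSPureExact_iff S hη.1.1).1 hη
  obtain ⟨g₁, hg₁⟩ := exists_extension_characterModule
    (h₁ (ModuleCat.of R (CharacterModule K))) (LinearMap.fst R _ _ ∘ₗ k.hom)
  obtain ⟨g₂, hg₂⟩ := h₂.exists_extension (LinearMap.fst R _ _ ∘ₗ LinearMap.snd R _ _ ∘ₗ k.hom)
  choose g₃ hg₃ using fun s : S => (h₃ s s.2).exists_extension
    (LinearMap.proj s ∘ₗ LinearMap.snd R _ _ ∘ₗ LinearMap.snd R _ _ ∘ₗ k.hom)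
  refine ⟨ModuleCat.ofHom (g₁.prod (g₂.prod (LinearMap.pi g₃))), ?_⟩
  ext x
  · exact DFunLike.congr_fun (LinearMap.congr_fun hg₁ x) _
  · exact LinearMap.congr_fun hg₂ x
  · exact LinearMap.congr_fun (hg₃ _) x

theorem IsSPureInjective.exists_extension {S : Submonoid R} {Y : ModuleCat.{u} R}
    (hY : IsSPureInjective S Y) {K E : ModuleCat.{u} R} {e : K ⟶ E} (he : IsSPure S e)
    (h : K ⟶ Y) : ∃ g : E ⟶ Y, e ≫ g = h :=
  have := he.mono
  have hη : (ShortComplex.mk e (Limits.cokernel.π e) (Limits.cokernel.condition e)).ShortExact :=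
    { exact := ShortComplex.exact_of_g_is_cokernel _ (Limits.cokernelIsCokernel e) }
  hY _ ((isSPureExact_iff S hη).2 he) h

theorem isSPureInjectivePreenvelope_toSPureHull (S : Submonoid R) (K : ModuleCat.{u} R) :
    IsSPureInjectivePreenvelope S (toSPureHull S K) :=
  ⟨isSPureInjective_sPureHull S K, fun _ hY h =>
    hY.exists_extension (isSPure_toSPureHull S K) h⟩

end Purity

/-! ### Pullbacks, pushouts and extension classes. -/

section Ideals

variable {R : Type u} [CommRing R]

open Abelian

theorem shortExact_of_isPullback {X Y Z U G : ModuleCat.{u} R} {i : X ⟶ Y} {p : Y ⟶ Z}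
    {w : i ≫ p = 0} (hη : (ShortComplex.mk i p w).ShortExact) {f : G ⟶ Z} {i' : X ⟶ U}
    {p' : U ⟶ G} {g : U ⟶ Y} (w' : i' ≫ p' = 0) (sq : IsPullback g p' p f) (hi : i' ≫ g = i) :
    (ShortComplex.mk i' p' w').ShortExact := by
  have : Mono i := hη.mono_f
  have : Epi p := hη.epi_g
  have hm : Mono i' := by
    have : Mono (i' ≫ g) := by rwa [hi]
    exact mono_of_mono i' g
  have he : Epi p' := (MorphismProperty.epimorphisms _).of_isPullback sq
    ((MorphismProperty.epimorphisms.iff p).2 this)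
  refine { exact := ShortComplex.exact_of_f_is_kernel _ (Limits.KernelFork.IsLimit.ofι' i' w'
    fun {W} k hk => ?_), mono_f := hm, epi_g := he }
  have hk' : (k ≫ g) ≫ p = 0 := by rw [Category.assoc, sq.w, reassoc_of% hk, Limits.zero_comp]
  exact ⟨hη.exact.lift (k ≫ g) hk', sq.hom_ext
    (by rw [Category.assoc, hi]; exact hη.exact.lift_f _ _) (by rw [Category.assoc, w', hk,
      Limits.comp_zero])⟩

theorem shortExact_of_isPushout {K P M E F : ModuleCat.{u} R} {i : K ⟶ P} {p : P ⟶ M}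
    {w : i ≫ p = 0} (hη : (ShortComplex.mk i p w).ShortExact) {e : K ⟶ E} {h : P ⟶ F}
    {n : E ⟶ F} {f : F ⟶ M} (w' : n ≫ f = 0) (sq : IsPushout i e h n) (hf : h ≫ f = p) :
    (ShortComplex.mk n f w').ShortExact := by
  have : Mono i := hη.mono_f
  have : Epi p := hη.epi_g
  have he : Epi f := by
    have : Epi (h ≫ f) := by rwa [hf]
    exact epi_of_epi h f
  have hm : Mono n := (MorphismProperty.monomorphisms _).of_isPushout sq.flip
    ((MorphismProperty.monomorphisms.iff i).2 ‹_›)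
  refine { exact := ShortComplex.exact_of_g_is_cokernel _ (Limits.CokernelCofork.IsColimit.ofπ' f w'
    fun {W} k hk => ?_), mono_f := hm, epi_g := he }
  have hk' : i ≫ h ≫ k = 0 := by rw [sq.w_assoc, hk, Limits.comp_zero]
  exact ⟨hη.exact.desc (h ≫ k) hk', sq.hom_ext
    (by rw [← Category.assoc, hf]; exact hη.exact.g_desc _ _) (by rw [← Category.assoc, w', hk,
      Limits.zero_comp])⟩

/-- Pulling back a short exact sequence. -/
theorem exists_pullback {X Y Z G : ModuleCat.{u} R} {i : X ⟶ Y} {p : Y ⟶ Z}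
    (w : i ≫ p = 0) (f : G ⟶ Z) : ∃ (U : ModuleCat.{u} R) (i' : X ⟶ U) (p' : U ⟶ G) (g : U ⟶ Y),
      i' ≫ p' = 0 ∧ IsPullback g p' p f ∧ i' ≫ g = i :=
  have sq := IsPullback.of_hasPullback p f
  ⟨_, sq.lift i 0 (by rw [w, Limits.zero_comp]), _, _, sq.lift_snd _ _ _, sq, sq.lift_fst _ _ _⟩

/-- Pushing out a short exact sequence. -/
theorem exists_pushout {K P M E : ModuleCat.{u} R} {i : K ⟶ P} {p : P ⟶ M}
    (w : i ≫ p = 0) (e : K ⟶ E) : ∃ (F : ModuleCat.{u} R) (h : P ⟶ F) (n : E ⟶ F) (f : F ⟶ M),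
      n ≫ f = 0 ∧ IsPushout i e h n ∧ h ≫ f = p :=
  have sq := IsPushout.of_hasPushout i e
  ⟨_, _, _, sq.desc p 0 (by rw [w, Limits.comp_zero]), sq.inr_desc _ _ _, sq, sq.inl_desc _ _ _⟩

theorem mk₀_comp_extClass_of_isPullback {X Y Z U G : ModuleCat.{u} R} {i : X ⟶ Y} {p : Y ⟶ Z}
    {w : i ≫ p = 0} (hη : (ShortComplex.mk i p w).ShortExact) {f : G ⟶ Z} {i' : X ⟶ U}
    {p' : U ⟶ G} {g : U ⟶ Y} {w' : i' ≫ p' = 0} (hη' : (ShortComplex.mk i' p' w').ShortExact)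
    (sq : IsPullback g p' p f) (hi : i' ≫ g = i) :
    (Ext.mk₀ f).comp hη.extClass (zero_add 1) = hη'.extClass := by
  have := ShortComplex.ShortExact.extClass_naturality hη' hη
    { τ₁ := 𝟙 _, τ₂ := g, τ₃ := f, comm₁₂ := by simpa using hi.symm, comm₂₃ := sq.w }
  rw [← this]
  exact Ext.comp_mk₀_id _

theorem extClass_comp_mk₀_of_isPushout {K P M E F : ModuleCat.{u} R} {i : K ⟶ P} {p : P ⟶ M}
    {w : i ≫ p = 0} (hη : (ShortComplex.mk i p w).ShortExact) {e : K ⟶ E} {h : P ⟶ F}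
    {n : E ⟶ F} {f : F ⟶ M} {w' : n ≫ f = 0} (hη' : (ShortComplex.mk n f w').ShortExact)
    (sq : IsPushout i e h n) (hf : h ≫ f = p) :
    hη.extClass.comp (Ext.mk₀ e) (add_zero 1) = hη'.extClass := by
  have := ShortComplex.ShortExact.extClass_naturality hη hη'
    { τ₁ := e, τ₂ := h, τ₃ := 𝟙 _, comm₁₂ := sq.w.symm, comm₂₃ := by simpa using hf }
  rw [this]
  exact Ext.mk₀_id_comp _

/-- The obstruction to extending `k` is its image under the connecting map `Hom(X₁, Y) → Ext¹(X₃,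
Y)`. -/
theorem exists_extension_iff_extClass_comp_eq_zero {η : ShortComplex (ModuleCat.{u} R)}
    (hη : η.ShortExact) {Y : ModuleCat.{u} R} (k : η.X₁ ⟶ Y) :
    (∃ g : η.X₂ ⟶ Y, η.f ≫ g = k) ↔ hη.extClass.comp (Ext.mk₀ k) (add_zero 1) = 0 := by
  constructor
  · rintro ⟨g, rfl⟩
    rw [← Ext.mk₀_comp_mk₀]
    exact hη.extClass_comp_assoc _
  · intro h
    obtain ⟨x, hx⟩ := Ext.contravariant_sequence_exact₁ hη _ (Ext.mk₀ k) rfl h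
    obtain ⟨g, rfl⟩ := (Ext.mk₀_bijective _ _).2 x
    rw [Ext.mk₀_comp_mk₀] at hx
    exact ⟨g, (Ext.mk₀_bijective _ _).1 hx⟩

theorem exists_lift_iff_comp_extClass_eq_zero {η : ShortComplex (ModuleCat.{u} R)}
    (hη : η.ShortExact) {Y : ModuleCat.{u} R} (k : Y ⟶ η.X₃) :
    (∃ g : Y ⟶ η.X₂, g ≫ η.g = k) ↔ (Ext.mk₀ k).comp hη.extClass (zero_add 1) = 0 := by
  constructor
  · rintro ⟨g, rfl⟩
    rw [← Ext.mk₀_comp_mk₀, Ext.comp_assoc_of_second_deg_zero, hη.comp_extClass, Ext.comp_zero]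
  · intro h
    obtain ⟨x, hx⟩ := Ext.covariant_sequence_exact₃ _ hη (Ext.mk₀ k) rfl h
    obtain ⟨g, rfl⟩ := (Ext.mk₀_bijective _ _).2 x
    rw [Ext.mk₀_comp_mk₀] at hx
    exact ⟨g, (Ext.mk₀_bijective _ _).1 hx⟩

theorem exists_eq_extClass_comp_mk₀ {η : ShortComplex (ModuleCat.{u} R)} (hη : η.ShortExact)
    [Projective η.X₂] {Y : ModuleCat.{u} R} (x : Ext.{u} η.X₃ Y 1) :
    ∃ k : η.X₁ ⟶ Y, hη.extClass.comp (Ext.mk₀ k) (add_zero 1) = x := by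
  obtain ⟨y, hy⟩ := Ext.contravariant_sequence_exact₃ hη _ x (Ext.eq_zero_of_projective _)
    (add_zero 1)
  obtain ⟨k, rfl⟩ := (Ext.mk₀_bijective _ _).2 y
  exact ⟨k, hy⟩

theorem exists_eq_mk₀_comp_extClass {η : ShortComplex (ModuleCat.{u} R)} (hη : η.ShortExact)
    [Injective η.X₂] {Y : ModuleCat.{u} R} (x : Ext.{u} Y η.X₁ 1) :
    ∃ k : Y ⟶ η.X₃, (Ext.mk₀ k).comp hη.extClass (zero_add 1) = x := by
  obtain ⟨y, hy⟩ := Ext.covariant_sequence_exact₁ _ hη x (Ext.eq_zero_of_injective _)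
    (zero_add 1)
  obtain ⟨k, rfl⟩ := (Ext.mk₀_bijective _ _).2 y
  exact ⟨k, hy⟩

/-- Every module has a projective presentation. -/
theorem exists_projective_presentation (M : ModuleCat.{u} R) :
    ∃ (K P : ModuleCat.{u} R) (i : K ⟶ P) (p : P ⟶ M) (w : i ≫ p = 0),
      Projective P ∧ (ShortComplex.mk i p w).ShortExact :=
  ⟨_, Projective.over M, _, _, Limits.kernel.condition (Projective.π M), inferInstance,
    { exact := ShortComplex.exact_of_f_is_kernel _ (Limits.kernelIsKernel (Projective.π M)) }⟩

/-- Every module embeds in an injective module. -/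
theorem exists_injective_presentation (M : ModuleCat.{u} R) :
    ∃ (I Z : ModuleCat.{u} R) (i : M ⟶ I) (p : I ⟶ Z) (w : i ≫ p = 0),
      Injective I ∧ (ShortComplex.mk i p w).ShortExact :=
  ⟨Injective.under M, _, _, _, Limits.cokernel.condition (Injective.ι M), inferInstance,
    { exact := ShortComplex.exact_of_g_is_cokernel _ (Limits.cokernelIsCokernel (Injective.ι M)) }⟩

theorem ExtVanishes.comp {A' A B B' C' C D D' : ModuleCat.{u} R} {f : A ⟶ B} {g : C ⟶ D}
    (h : ExtVanishes f g) (a : A' ⟶ A) (b : B ⟶ B') (c : C' ⟶ C) (d : D ⟶ D') :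
    ExtVanishes (a ≫ f ≫ b) (c ≫ g ≫ d) := by
  intro x
  have := h (((Ext.mk₀ b).comp x (zero_add 1)).comp (Ext.mk₀ c) (add_zero 1))
  rw [← Ext.mk₀_comp_mk₀, ← Ext.mk₀_comp_mk₀, ← Ext.mk₀_comp_mk₀, ← Ext.mk₀_comp_mk₀]
  have h2 := congrArg (fun y => (Ext.mk₀ a).comp (y.comp (Ext.mk₀ d) (add_zero 1)) (zero_add 1)) this
  simpa [Ext.comp_assoc_of_third_deg_zero, Ext.comp_assoc_of_second_deg_zero] using h2

theorem isIdeal_rightPerp (I : MorphismProperty (ModuleCat.{u} R)) : IsIdeal (rightPerp I) where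
  zero A B _ _ i _ x := by simp
  add f g hf hg A B i hi x := by
    rw [Ext.mk₀_add, Ext.comp_add, hf _ _ i hi, hg _ _ i hi, add_zero]
  neg f hf A B i hi x := by rw [Ext.mk₀_neg, Ext.comp_neg, hf _ _ i hi, neg_zero]
  comp h f g hf A B i hi := by simpa using (hf _ _ i hi).comp (𝟙 _) (𝟙 _) h g

theorem isIdeal_leftPerp (J : MorphismProperty (ModuleCat.{u} R)) : IsIdeal (leftPerp J) where
  zero A B _ _ i _ x := by simp
  add f g hf hg A B i hi x := by
    rw [Ext.mk₀_add, Ext.add_comp, Ext.add_comp, hf _ _ i hi, hg _ _ i hi, add_zero]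
  neg f hf A B i hi x := by
    rw [Ext.mk₀_neg, Ext.neg_comp, Ext.neg_comp, hf _ _ i hi, neg_zero]
  comp h f g hf A B i hi := by simpa using (hf _ _ i hi).comp h g (𝟙 _) (𝟙 _)

/-! ### Phantom morphisms as a left perpendicular class, and their precovers. -/

/-- `f` is `S`-phantom if and only if `Ext¹_R(f, E) = 0` for all `S`-pure injective `E`. -/
theorem sPh_iff (S : Submonoid R) {G Z : ModuleCat.{u} R} (f : G ⟶ Z) :
    SPh S f ↔ ∀ E : ModuleCat.{u} R, IsSPureInjective S E → ExtVanishes f (𝟙 E) := by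
  constructor
  · intro hf E hE x
    obtain ⟨K, P, i, p, w, hP, hη⟩ := exists_projective_presentation Z
    obtain ⟨k, rfl⟩ := exists_eq_extClass_comp_mk₀ hη x
    obtain ⟨U, i', p', g, w', sq, hi⟩ := exists_pullback w f
    -- With `x = k_*[η]`, the class `f^*x` is `k_*` of an `S`-pure sequence; it vanishes because `k`
    -- extends along that sequence.
    have hS := hf _ _ i p w hη _ i' p' g w' sq hi
    have := (exists_extension_iff_extClass_comp_eq_zero hS.1.1 k).1 (hE _ hS k)
    rw [Ext.comp_mk₀_id, ← Ext.comp_assoc_of_third_deg_zero]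
    exact (congrArg (fun y => y.comp (Ext.mk₀ k) (add_zero 1))
      (mk₀_comp_extClass_of_isPullback hη hS.1.1 sq hi)).trans this
  · intro h X Y i p w hη U i' p' g w' sq hi
    have hη' := shortExact_of_isPullback hη w' sq hi
    refine (isSPureExact_iff S hη').2 ?_
    -- Testing on `[η]` pushed out to the hull of `X` extends the hull map over `U`. As that map is
    -- `S`-pure, so is its first factor `i'`.
    have := h _ (isSPureInjective_sPureHull S X)
      (hη.extClass.comp (Ext.mk₀ (toSPureHull S X)) (add_zero 1))
    rw [Ext.comp_mk₀_id, ← Ext.comp_assoc_of_third_deg_zero] at this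
    obtain ⟨r, hr⟩ := (exists_extension_iff_extClass_comp_eq_zero hη' (toSPureHull S X)).2
      ((congrArg (fun y => y.comp (Ext.mk₀ (toSPureHull S X)) (add_zero 1))
        (mk₀_comp_extClass_of_isPullback hη hη' sq hi)).symm.trans this)
    exact IsSPure.of_comp (hr ▸ isSPure_toSPureHull S X : IsSPure S (i' ≫ r))

theorem rightPerp_sPh_id {S : Submonoid R} {E : ModuleCat.{u} R} (hE : IsSPureInjective S E) :
    rightPerp (SPh S) (𝟙 E) :=
  fun _ _ i hi => (sPh_iff S i).1 hi E hE

theorem rightPerp_sPh_of_isSPureInjective {S : Submonoid R} {K E : ModuleCat.{u} R}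
    (hE : IsSPureInjective S E) (e : K ⟶ E) : rightPerp (SPh S) e := by
  simpa using (isIdeal_rightPerp (SPh S)).comp e (𝟙 E) (𝟙 E) (rightPerp_sPh_id hE)

theorem sPh_eq_leftPerp_rightPerp (S : Submonoid R) : SPh S = leftPerp (rightPerp (SPh S)) := by
  ext A B f
  exact ⟨fun hf _ _ _ hj => hj _ _ f hf,
    fun hf => (sPh_iff S f).2 fun E hE => hf _ _ _ (rightPerp_sPh_id hE)⟩

theorem isIdeal_sPh (S : Submonoid R) : IsIdeal (SPh S) := by
  rw [sPh_eq_leftPerp_rightPerp]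
  exact isIdeal_leftPerp _

/-- A short exact sequence ending in an `I`-morphism and starting in an object whose identity lies
in `I^⊥` gives an `I`-precover. -/
theorem isPrecover_of_rightPerp_id {I : MorphismProperty (ModuleCat.{u} R)}
    {η : ShortComplex (ModuleCat.{u} R)} (hη : η.ShortExact) (hg : I η.g)
    (h : rightPerp I (𝟙 η.X₁)) : IsPrecover I η.g := by
  refine ⟨hg, fun X' i' hi' => (exists_lift_iff_comp_extClass_eq_zero hη i').2 ?_⟩
  simpa using h _ _ i' hi' hη.extClass

/-- The pushout of a projective presentation along an `S`-pure injective preenvelope is a special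
`S`-phantom precover. -/
theorem isSpecialPrecover_sPh_of_isPushout {S : Submonoid R} {M K P E F : ModuleCat.{u} R}
    {i : K ⟶ P} {p : P ⟶ M} {w : i ≫ p = 0} {e : K ⟶ E} {h : P ⟶ F} {n : E ⟶ F} {f : F ⟶ M}
    (w' : n ≫ f = 0) [Projective P] (hη : (ShortComplex.mk i p w).ShortExact)
    (he : IsSPureInjectivePreenvelope S e) (sq : IsPushout i e h n) (hf : h ≫ f = p) :
    IsSpecialPrecover (SPh S) f := by
  have hη' := shortExact_of_isPushout hη w' sq hf
  refine ⟨isPrecover_of_rightPerp_id hη' ((sPh_iff S f).2 fun E' hE' x => ?_)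
    (rightPerp_sPh_id he.1), _, _, _, i, p, w, e, n, h, w', hη, hη',
    rightPerp_sPh_of_isSPureInjective he.1 e, sq, hf⟩
  -- Here `x = k_*[η] = k'_*e_*[η] = k'_*[η']`, and `f^*[η'] = 0` because `f` is the epimorphism of
  -- `η'`.
  obtain ⟨k, rfl⟩ := exists_eq_extClass_comp_mk₀ hη x
  obtain ⟨k', rfl⟩ := he.2 E' hE' k
  have h₁ := hη'.comp_extClass
  rw [← extClass_comp_mk₀_of_isPushout hη hη' sq hf] at h₁
  have h₂ := congrArg (fun y => y.comp (Ext.mk₀ k') (add_zero 1)) h₁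
  simpa [← Ext.mk₀_comp_mk₀, Ext.comp_assoc_of_third_deg_zero] using h₂

theorem isSpecialPrecovering_sPh (S : Submonoid R) : IsSpecialPrecovering (SPh S) := by
  intro M
  obtain ⟨K, P, i, p, w, hP, hη⟩ := exists_projective_presentation M
  obtain ⟨F, h, n, f, w', sq, hf⟩ := exists_pushout w (toSPureHull S K)
  exact ⟨F, f, isSpecialPrecover_sPh_of_isPushout w' hη
    (isSPureInjectivePreenvelope_toSPureHull S K) sq hf⟩

/-! ### Special preenvelopes and the cotorsion pair. -/

/-- The ideal version of Salce's lemma: if the ideal `I` is precovering, then `I^⊥` is special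
preenveloping. -/
theorem isSpecialPreenveloping_rightPerp {I : MorphismProperty (ModuleCat.{u} R)} (hI : IsIdeal I)
    (h : ∀ M : ModuleCat.{u} R, ∃ (X : ModuleCat.{u} R) (i : X ⟶ M), IsPrecover I i) :
    IsSpecialPreenveloping (rightPerp I) := by
  intro M
  obtain ⟨Y, Z, y, z, w, hY, hη⟩ := exists_injective_presentation M
  obtain ⟨Q, i, hi⟩ := h Z
  obtain ⟨X, j, q, g, w', sq, hj⟩ := exists_pullback w i
  have hη' := shortExact_of_isPullback hη w' sq hj
  have hcl := mk₀_comp_extClass_of_isPullback hη hη' sq hj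
  have hi' : leftPerp (rightPerp I) i := fun _ _ _ hj => hj _ _ i hi.1
  refine ⟨X, j, ⟨fun A B a ha x => ?_, fun X' j' hj' => ?_⟩, Y, Z, Q, y, z, w, i, q, g, w', hη, hη',
    hi', sq, hj⟩
  -- Injectivity of `Y` gives `x = k^*[η]`. As `a ≫ k` is in `I`, it factors as `l ≫ i`, so `a^*x =
  -- l^*i^*[η] = l^*[η']`, which `j_*` kills.
  · obtain ⟨k, rfl⟩ := exists_eq_mk₀_comp_extClass hη x
    obtain ⟨l, hl⟩ := hi.2 A (a ≫ k) (by simpa using hI.comp (𝟙 _) a k ha)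
    rw [Ext.mk₀_comp_mk₀_assoc]
    change ((Ext.mk₀ (a ≫ k)).comp _ _).comp _ _ = 0
    rw [← hl, ← Ext.mk₀_comp_mk₀, Ext.comp_assoc_of_second_deg_zero, hcl,
      Ext.comp_assoc_of_third_deg_zero]
    exact (congrArg (fun y => (Ext.mk₀ l).comp y (zero_add 1)) hη'.extClass_comp).trans
      (Ext.comp_zero _ _ _ _ _)
  -- The obstruction `j'_*[η']` equals `j'_*i^*[η]`, which is zero since `Ext¹(i, j') = 0`.
  · refine (exists_extension_iff_extClass_comp_eq_zero hη' j').2 ?_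
    have := hi' _ _ j' hj' hη.extClass
    exact (congrArg (fun y => y.comp (Ext.mk₀ j') (add_zero 1)) hcl).symm.trans this

theorem isCompleteIdealCotorsionPair_sPh (S : Submonoid R) :
    IsCompleteIdealCotorsionPair (SPh S) (rightPerp (SPh S)) where
  isIdealCotorsionPair :=
    { isIdeal_left := isIdeal_sPh S
      isIdeal_right := isIdeal_rightPerp _
      right_eq := rfl
      left_eq := sPh_eq_leftPerp_rightPerp S }
  isSpecialPrecovering := isSpecialPrecovering_sPh S
  isSpecialPreenveloping := isSpecialPreenveloping_rightPerp (isIdeal_sPh S) fun M =>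
    (isSpecialPrecovering_sPh S M).imp fun _ ⟨i, hi⟩ => ⟨i, hi.1⟩

end Ideals

end SPhantom

theorem mainTheorem1 {R : Type u} [CommRing R] (S : Submonoid R) :
    -- the `S`-phantom morphisms form an ideal, and every module has a special `S`-phantom precover
    IsIdeal (SPh S) ∧
    (∀ M : ModuleCat.{u} R, ∃ (F : ModuleCat.{u} R) (f : F ⟶ M), IsSpecialPrecover (SPh S) f) ∧
    IsSpecialPrecovering (SPh S) ∧
    -- `(S-Ph, S-Ph^⊥)` is a complete ideal cotorsion pair
    IsCompleteIdealCotorsionPair (SPh S) (rightPerp (SPh S)) ∧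
    -- every module has an `S`-pure injective preenvelope
    (∀ K : ModuleCat.{u} R, ∃ (E : ModuleCat.{u} R) (e : K ⟶ E),
      IsSPureInjectivePreenvelope S e) ∧
    -- the pushout `0 → E → F → M → 0` of any projective presentation `0 → K → P → M → 0` along
    -- any `S`-pure injective preenvelope `e : K ⟶ E` yields a special `S`-phantom precover,
    -- special because `e ∈ S-Ph^⊥`
    (∀ (M K P E F : ModuleCat.{u} R) (i : K ⟶ P) (p : P ⟶ M) (w : i ≫ p = 0)
      (e : K ⟶ E) (h : P ⟶ F) (n : E ⟶ F) (f : F ⟶ M) (w' : n ≫ f = 0),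
      Projective P → (ShortComplex.mk i p w).ShortExact → IsSPureInjectivePreenvelope S e →
      IsPushout i e h n → h ≫ f = p →
      (ShortComplex.mk n f w').ShortExact ∧ rightPerp (SPh S) e ∧
        IsSpecialPrecover (SPh S) f) := by
  refine ⟨isIdeal_sPh S, isSpecialPrecovering_sPh S, isSpecialPrecovering_sPh S,
    isCompleteIdealCotorsionPair_sPh S,
    fun K => ⟨_, _, isSPureInjectivePreenvelope_toSPureHull S K⟩, ?_⟩
  intro M K P E F i p w e h n f w' hP hη he sq hf
  exact ⟨shortExact_of_isPushout hη w' sq hf, rightPerp_sPh_of_isSPureInjective he.1 e,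
    isSpecialPrecover_sPh_of_isPushout w' hη he sq hf⟩
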